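/- Conventions. A path $\omega=(\omega_1,\omega_2,\dots)$ is an infinite binary sequence, $\omega_{1:n}=(\omega_1,\dots,\omega_n)$, and $\mathbb{S}$ is the set of all finite binary sequences (situations), including the empty one $\square$. An interval forecast is a non-empty closed interval $I\subseteq[0,1]$; a forecasting system $\varphi$ assigns an interval forecast $\varphi(s)=[\underline{\varphi}(s),\overline{\varphi}(s)]$ to every $s\in\mathbb{S}$. It is precise if $\underline{\varphi}=\overline{\varphi}$, in which case we also write $\varphi(s)$ for this common real value, and an interval forecast $I$ is identified with the stationary forecasting system that is constantly equal to $I$. A real map on a countable domain of finite objects is lower semicomputable if it is the pointwise limit of a recursive, pointwise non-decreasing sequence of rational maps, and computable if it and its negative are both lower semicomputable; $\varphi$ is computable if $\underline{\varphi}$ and $\overline{\varphi}$ are. A test supermartingale for $\varphi$ is a map $T\colon\mathbb{S}\to[0,\infty)$ with $T(\square)=1$ and $p\,T(s1)+(1-p)\,T(s0)\le T(s)$ for all $s\in\mathbb{S}$ and $p\in\varphi(s)$. The map $\mathbb S\to[0,\infty)$ generated by $D\colon\mathbb{S}\times\{0,1\}\to[0,\infty)$ is $(x_1,\dots,x_n)\mapsto\prod_{k=0}^{n-1}D((x_1,\dots,x_k),x_{k+1})$.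 A path $\omega$ is ML-random (respectively wML-random, C-random) for $\varphi$ if $\limsup_{n\to\infty}T(\omega_{1:n})<\infty$ for every test supermartingale $T$ for $\varphi$ that is lower semicomputable (respectively generated by a lower semicomputable $D$, computable). It is CH-random for $\varphi$ if for every recursive $S\colon\mathbb{S}\to\{0,1\}$ with $\sum_{k=0}^{\infty}S(\omega_{1:k})=\infty$, $$\liminf_{n\to\infty}\frac{\sum_{k=0}^{n-1}S(\omega_{1:k})[\omega_{k+1}-\underline{\varphi}(\omega_{1:k})]}{\sum_{k=0}^{n-1}S(\omega_{1:k})}\ge0\quad\text{and}\quad\limsup_{n\to\infty}\frac{\sum_{k=0}^{n-1}S(\omega_{1:k})[\omega_{k+1}-\overline{\varphi}(\omega_{1:k})]}{\sum_{k=0}^{n-1}S(\omega_{1:k})}\le0.$$ For a randomness notion $\mathrm{R}$, let $I_{\mathrm{R}}(\omega)$ be the intersection of all interval forecasts that $\omega$ is $\mathrm{R}$-random for. Theorem. Let $\mathrm{R}\in\{\mathrm{ML},\mathrm{wML},\mathrm{C},\mathrm{CH}\}$ and let the path $\omega$ be $\mathrm{R}$-random for a computable precise forecasting system $\varphi$.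 Then $$I_{\mathrm{R}}(\omega)=I_{\mathrm{CH}}(\omega)=I_\varphi(\omega),\qquad\text{where } I_\varphi(\omega)=\Big[\liminf_{n\to\infty}\varphi(\omega_{1:n}),\ \limsup_{n\to\infty}\varphi(\omega_{1:n})\Big].$$ -/

import Mathlib

open Filter Topology

noncomputable section

namespace ImpreciseRandomness

/-! ### Computability of natural, rational and real maps on encodable domains -/

/-- A rational map is recursive if it is `(-1) ^ c * a / b` for (total) recursive natural maps
`a`, `b`, `c` with `b` nowhere zero. -/
def RecursiveRat {α : Type} [Primcodable α] (q : α → ℚ) : Prop :=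
  ∃ a b c : α → ℕ, Computable a ∧ Computable b ∧ Computable c ∧
    ∀ d, b d ≠ 0 ∧ q d = (-1) ^ c d * ((a d : ℚ) / (b d : ℚ))

/-- A real map is lower semicomputable if it is the pointwise limit of a recursive,
non-decreasing sequence of rational maps. -/
def LowerSemicomputable {α : Type} [Primcodable α] (r : α → ℝ) : Prop :=
  ∃ q : α × ℕ → ℚ, RecursiveRat q ∧
    (∀ d n, q (d, n) ≤ q (d, n + 1)) ∧
    ∀ d, Tendsto (fun n => (q (d, n) : ℝ)) atTop (𝓝 (r d))

/-- A real map is upper semicomputable if its negative is lower semicomputable. -/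
def UpperSemicomputable {α : Type} [Primcodable α] (r : α → ℝ) : Prop :=
  LowerSemicomputable fun d => -r d

/-- A real map is computable if it is both lower and upper semicomputable. -/
def ComputableReal {α : Type} [Primcodable α] (r : α → ℝ) : Prop :=
  LowerSemicomputable r ∧ UpperSemicomputable r

/-! ### Paths, situations, forecasting systems -/

/-- A path is an infinite binary sequence; `ω n` is the outcome of the `(n+1)`-st variable, with
`true` for the outcome `1` and `false` for `0`. -/
abbrev Path := ℕ → Bool

/-- A situation is a finite binary sequence, listed from the first outcome to the last one. -/
abbrev Situation := List Bool

/-- The initial segment consisting of the first `n` outcomes of a path. -/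
def initialSegment (ω : Path) (n : ℕ) : Situation := (List.range n).map ω

/-- The numerical value, `0` or `1`, of a binary digit. -/
def bit (x : Bool) : ℝ := if x then 1 else 0

/-- Interval forecasts: non-empty closed subintervals of the real unit interval. -/
abbrev IntervalForecast := NonemptyInterval unitInterval

/-- The lower bound `min I`, as a real number. -/
def IntervalForecast.lo (I : IntervalForecast) : ℝ := (I.fst : ℝ)

/-- The upper bound `max I`, as a real number. -/
def IntervalForecast.hi (I : IntervalForecast) : ℝ := (I.snd : ℝ)

/-- The set of real numbers that belong to an interval forecast. -/
def IntervalForecast.toSet (I : IntervalForecast) : Set ℝ :=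
  Set.Icc (IntervalForecast.lo I) (IntervalForecast.hi I)

/-- A forecasting system attaches an interval forecast to every situation. -/
abbrev ForecastingSystem := Situation → IntervalForecast

/-- The real process of lower bounds of a forecasting system. -/
def lowerForecast (φ : ForecastingSystem) (s : Situation) : ℝ := IntervalForecast.lo (φ s)

/-- The real process of upper bounds of a forecasting system. -/
def upperForecast (φ : ForecastingSystem) (s : Situation) : ℝ := IntervalForecast.hi (φ s)

/-- A forecasting system is precise if its lower and upper bounds coincide. -/
def IsPrecise (φ : ForecastingSystem) : Prop := lowerForecast φ = upperForecast φ

/-- A forecasting system is computable if its lower and upper bounds are. -/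
def IsComputable (φ : ForecastingSystem) : Prop :=
  ComputableReal (lowerForecast φ) ∧ ComputableReal (upperForecast φ)

/-- The stationary forecasting system with the same interval forecast in every situation. -/
def stationary (I : IntervalForecast) : ForecastingSystem := fun _ => I

/-! ### Supermartingales -/

/-- The expectation of a gamble `f` on a binary variable that is `1` with probability `p`. -/
def expectation (p : ℝ) (f : Bool → ℝ) : ℝ := p * f true + (1 - p) * f false

/-- A gamble is allowable for an interval forecast if none of its expectations is positive. -/
def Allowable (I : IntervalForecast) (f : Bool → ℝ) : Prop :=
  ∀ p ∈ IntervalForecast.toSet I, expectation p f ≤ 0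

/-- The process difference of a real process. -/
def processDifference (M : Situation → ℝ) (s : Situation) (x : Bool) : ℝ := M (s ++ [x]) - M s

/-- A real process is a supermartingale for `φ` if all its increments are allowable. -/
def IsSupermartingale (φ : ForecastingSystem) (M : Situation → ℝ) : Prop :=
  ∀ s, Allowable (φ s) (processDifference M s)

/-- Test supermartingales: non-negative supermartingales with initial value `1`. -/
def IsTest (φ : ForecastingSystem) (T : Situation → ℝ) : Prop :=
  IsSupermartingale φ T ∧ (∀ s, 0 ≤ T s) ∧ T [] = 1

/-- The real process generated by a multiplier process `D`: its value in a situation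
`x₁ … xₙ` is the product of the multipliers `D (x₁ … xₖ) xₖ₊₁` for `k < n`. -/
def generated (D : Situation → Bool → ℝ) (s : Situation) : ℝ :=
  ∏ k ∈ Finset.range s.length, D (s.take k) (s.getD k false)

/-- Lower semicomputable test supermartingales. -/
def mlTests (φ : ForecastingSystem) : Set (Situation → ℝ) :=
  {T | IsTest φ T ∧ LowerSemicomputable T}

/-- Test supermartingales generated by a non-negative lower semicomputable multiplier process. -/
def weakMLTests (φ : ForecastingSystem) : Set (Situation → ℝ) :=
  {T | IsTest φ T ∧ ∃ D : Situation → Bool → ℝ, (∀ s x, 0 ≤ D s x) ∧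
    LowerSemicomputable (fun d : Situation × Bool => D d.1 d.2) ∧ T = generated D}

/-- Computable test supermartingales. -/
def computableTests (φ : ForecastingSystem) : Set (Situation → ℝ) :=
  {T | IsTest φ T ∧ ComputableReal T}

/-- A real process is unbounded on a path if its limit superior along the path is infinite. -/
def UnboundedOn (T : Situation → ℝ) (ω : Path) : Prop :=
  limsup (fun n => (T (initialSegment ω n) : EReal)) atTop = ⊤

/-! ### Church randomness -/

/-- The number of outcomes, among the first `n` ones of `ω`, that `S` selects. -/
def selectionCount (S : Situation → Bool) (ω : Path) (n : ℕ) : ℝ :=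
  ∑ k ∈ Finset.range n, bit (S (initialSegment ω k))

/-- The average excess, over the outcomes selected by `S` among the first `n` ones of `ω`, of the
outcome over the value of the real process `F` just before. -/
def selectedAverage (S : Situation → Bool) (F : Situation → ℝ) (ω : Path) (n : ℕ) : ℝ :=
  (∑ k ∈ Finset.range n,
    bit (S (initialSegment ω k)) * (bit (ω k) - F (initialSegment ω k))) / selectionCount S ω n

/-- Church randomness: for every recursive selection process that selects infinitely many
outcomes of `ω`, the selected averages are asymptotically compatible with the forecasts. -/
def ChurchRandom (φ : ForecastingSystem) (ω : Path) : Prop :=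
  ∀ S : Situation → Bool, Computable S → Tendsto (selectionCount S ω) atTop atTop →
    0 ≤ liminf (selectedAverage S (lowerForecast φ) ω) atTop ∧
      limsup (selectedAverage S (upperForecast φ) ω) atTop ≤ 0

/-! ### Randomness notions and the associated intervals -/

/-- Martin-Löf, weak Martin-Löf, computable and Church randomness. -/
inductive Notion
  | ML
  | wML
  | C
  | CH

/-- `IsRandom R φ ω`: the path `ω` is `R`-random for the forecasting system `φ`. -/
def IsRandom (R : Notion) (φ : ForecastingSystem) (ω : Path) : Prop :=
  match R with
  | .ML => ∀ T ∈ mlTests φ, ¬ UnboundedOn T ω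
  | .wML => ∀ T ∈ weakMLTests φ, ¬ UnboundedOn T ω
  | .C => ∀ T ∈ computableTests φ, ¬ UnboundedOn T ω
  | .CH => ChurchRandom φ ω

/-- The interval forecasts (as stationary forecasting systems) that `ω` is `R`-random for. -/
def randomIntervals (R : Notion) (ω : Path) : Set IntervalForecast :=
  {I | IsRandom R (stationary I) ω}

/-- The intersection `I_R(ω)` of all interval forecasts that `ω` is `R`-random for. -/
def intersectionInterval (R : Notion) (ω : Path) : Set ℝ :=
  ⋂ I ∈ randomIntervals R ω, IntervalForecast.toSet I

/-- The interval `I_φ(ω)` from the limit inferior of the lower forecasts along `ω` to the limit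
superior of the upper ones. -/
def forecastInterval (φ : ForecastingSystem) (ω : Path) : Set ℝ :=
  Set.Icc (liminf (fun n => lowerForecast φ (initialSegment ω n)) atTop)
    (limsup (fun n => upperForecast φ (initialSegment ω n)) atTop)

end ImpreciseRandomness

end

/-!
The four notions are treated simultaneously, through two facts that hold for each of them.

* *Averages* (`IsRandom.eventually_excess_le`, `IsRandom.eventually_le_excess`). If `ω` is random for
  `ψ`, and a rational number `g` dominates the forecasts of `ψ` on a recursive set of situations,
  then the outcomes selected by that set do not exceed `g` on average; and symmetrically for lower
  bounds. For the notions defined by supermartingales, a strategy that stakes a small fixed rational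
  fraction `η` of its capital on each selected outcome has capital at least
  `exp (η * excess - 4 * η ^ 2 * count)`, which is unbounded if the excess is infinitely often a
  fixed positive proportion of the count. Because `g` and `η` are rational, the strategy is generated
  by a recursive positive rational multiplier process, so that it is a test for all these notions.
* *Transfer* (`IsRandom.of_eventually_subset`). If the forecasts of `φ` along `ω` are from some point
  on recognised by a recursive condition as contained in those of `ψ`, randomness for `φ` implies
  randomness for `ψ`. Given a test supermartingale `T` for `ψ`, the process that waits until that
  point, then follows a scaled copy of `T`, and is frozen once the condition fails, is one for `φ`.
  It is obtained from `T` by recursive substitution and rational scaling, which preserve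
  semicomputability, whereas quotients of values of `T` would not. When `T` is generated by a
  multiplier process, the latter is replaced by `1` wherever `T` is not followed
  (`followFrom_generated`).

A computable real map need not admit a decision procedure for comparison with a constant, but two
distinct rational thresholds can always be separated recursively
(`ComputableReal.exists_separating`), and this provides the recursive conditions above.

The transfer principle shows that `ω` is random for stationary forecasts with rational bounds
arbitrarily close to the limits inferior and superior of the forecasts of `φ`; by the averages these
forecasts also make it Church random, and so both intersections are contained in `I_φ(ω)`.
Conversely, suppose that `ω` is random for the stationary forecast `J` and that the forecasts of `φ`
along `ω` exceed `max J` by some margin infinitely often (the other side is similar). On a recursive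
set containing those situations, the averages with respect to `φ` and to `J` are separated by a
positive margin, which is contradictory (`not_isRandom_of_separated`).
-/

open Filter Topology

namespace ImpreciseRandomness

/-! ### Recursion on situations -/

/-- Maps that are defined by recursion on the last outcome of a situation are recursive. -/
theorem computable_of_concat {σ : Type} [Primcodable σ] {F : Situation → σ}
    {h : Situation × σ × Bool → σ} (hh : Computable h)
    (hF : ∀ s x, F (s ++ [x]) = h (s, F s, x)) : Computable F := by
  have hstep : Computable fun p : Situation × ℕ × σ =>
      h (p.1.take p.2.1, p.2.2, p.1.getD p.2.1 false) := by
    have h1 : Computable fun p : Situation × ℕ × σ => p.2.1 := Computable.fst.comp Computable.snd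
    exact hh.comp ((Primrec.list_take.to_comp.comp h1 Computable.fst).pair
      ((Computable.snd.comp Computable.snd).pair
        ((Primrec.list_getD false).to_comp.comp Computable.fst h1)))
  refine (Computable.nat_rec (f := fun s : Situation => s.length) (g := fun _ => F [])
    (h := fun s p => h (s.take p.1, p.2, s.getD p.1 false)) Primrec.list_length.to_comp
    (Computable.const _) hstep.to₂).of_eq fun s => ?_
  have key : ∀ n ≤ s.length, (Nat.rec (F [])
      (fun k acc => h (s.take k, acc, s.getD k false)) n : σ) = F (s.take n) := by
    intro n
    induction n with
    | zero => intro _; simp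
    | succ n ih =>
      intro hn
      have hn' : n < s.length := hn
      have e : s.take (n + 1) = s.take n ++ [s.getD n false] := by
        rw [List.take_succ_eq_append_getElem hn', List.getD_eq_getElem _ _ hn']
      rw [e, hF, ← ih hn'.le]
  simpa using key s.length le_rfl

theorem prod_range_concat {M : Type} [CommMonoid M] (a : Situation → Bool → M) (s : Situation)
    (x : Bool) :
    ∏ k ∈ Finset.range (s ++ [x]).length, a ((s ++ [x]).take k) ((s ++ [x]).getD k false) =
      (∏ k ∈ Finset.range s.length, a (s.take k) (s.getD k false)) * a s x := by
  rw [List.length_append, List.length_singleton, Finset.prod_range_succ]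
  congr 1
  · refine Finset.prod_congr rfl fun k hk => ?_
    have hk' : k < s.length := Finset.mem_range.1 hk
    rw [List.take_append_of_le_length hk'.le, List.getD_append _ _ _ _ hk']
  · simp

theorem computable_prod {a : Situation × Bool → ℕ} (ha : Computable a) :
    Computable fun s : Situation =>
      ∏ k ∈ Finset.range s.length, a (s.take k, s.getD k false) :=
  computable_of_concat (h := fun p => p.2.1 * a (p.1, p.2.2))
    (Primrec.nat_mul.to_comp.comp (Computable.fst.comp Computable.snd)
      (ha.comp (Computable.fst.pair (Computable.snd.comp Computable.snd))))
    fun s x => prod_range_concat (fun s x => a (s, x)) s x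

theorem generated_concat (D : Situation → Bool → ℝ) (s : Situation) (x : Bool) :
    generated D (s ++ [x]) = generated D s * D s x :=
  prod_range_concat D s x

theorem generated_nil (D : Situation → Bool → ℝ) : generated D [] = 1 := rfl

theorem generated_nonneg {D : Situation → Bool → ℝ} (hD : ∀ s x, 0 ≤ D s x) (s : Situation) :
    0 ≤ generated D s :=
  Finset.prod_nonneg fun _ _ => hD _ _

/-! ### Recursive rational maps -/

section Computability

variable {α β : Type} [Primcodable α] [Primcodable β]

theorem computable_find {p : α → ℕ → Bool} (hp : Computable₂ p) (h : ∀ a, ∃ n, p a n = true) :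
    Computable fun a => Nat.find (h a) := by
  refine (Partrec.rfind (p := fun a n => Part.some (p a n)) hp.partrec₂).of_eq_tot fun a => ?_
  refine Nat.mem_rfind.2 ⟨by simpa using Nat.find_spec (h a), fun {m} hm => ?_⟩
  simpa using Nat.find_min (h a) hm

theorem RecursiveRat.comp {q : β → ℚ} (hq : RecursiveRat q) {h : α → β} (hh : Computable h) :
    RecursiveRat fun d => q (h d) := by
  obtain ⟨a, b, c, ha, hb, hc, H⟩ := hq
  exact ⟨_, _, _, ha.comp hh, hb.comp hh, hc.comp hh, fun d => H (h d)⟩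

theorem RecursiveRat.of_finite [Finite β] (f : β → ℚ) : RecursiveRat f := by
  refine ⟨fun d => (f d).num.natAbs, fun d => (f d).den, fun d => if f d < 0 then 1 else 0,
    (Primrec.dom_finite _).to_comp, (Primrec.dom_finite _).to_comp,
    (Primrec.dom_finite _).to_comp, fun d => ⟨(f d).den_nz, ?_⟩⟩
  have e : (((f d).num.natAbs : ℕ) : ℚ) / (f d).den = |f d| := by
    rw [Nat.cast_natAbs, Int.cast_abs]
    conv_rhs => rw [← Rat.num_div_den (f d), abs_div, Nat.abs_cast]
  dsimp only
  rw [e]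
  split_ifs with h
  · simp [abs_of_neg h]
  · simp [abs_of_nonneg (not_lt.1 h)]

theorem RecursiveRat.const (r : ℚ) : RecursiveRat fun _ : α => r :=
  (RecursiveRat.of_finite fun _ : Unit => r).comp (Computable.const ())

theorem RecursiveRat.mul {q r : α → ℚ} (hq : RecursiveRat q) (hr : RecursiveRat r) :
    RecursiveRat fun d => q d * r d := by
  obtain ⟨a, b, c, ha, hb, hc, H⟩ := hq
  obtain ⟨a', b', c', ha', hb', hc', H'⟩ := hr
  refine ⟨fun d => a d * a' d, fun d => b d * b' d, fun d => c d + c' d,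
    Primrec.nat_mul.to_comp.comp ha ha', Primrec.nat_mul.to_comp.comp hb hb',
    Primrec.nat_add.to_comp.comp hc hc', fun d => ⟨mul_ne_zero (H d).1 (H' d).1, ?_⟩⟩
  dsimp only
  rw [(H d).2, (H' d).2]
  push_cast
  rw [pow_add, mul_div_mul_comm]
  ring

theorem RecursiveRat.cond {q r : α → ℚ} {g : α → Bool} (hg : Computable g) (hq : RecursiveRat q)
    (hr : RecursiveRat r) : RecursiveRat fun d => if g d = true then q d else r d := by
  obtain ⟨a, b, c, ha, hb, hc, H⟩ := hq
  obtain ⟨a', b', c', ha', hb', hc', H'⟩ := hr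
  refine ⟨_, _, _, hg.cond ha ha', hg.cond hb hb', hg.cond hc hc', fun d => ?_⟩
  cases hgd : g d
  · simpa [hgd] using H' d
  · simpa [hgd] using H d

/-- A recursive rational map can effectively be compared with a rational constant. -/
theorem RecursiveRat.computable_lt {q : α → ℚ} (hq : RecursiveRat q) (r : ℚ) :
    Computable fun d => decide (r < q d) := by
  obtain ⟨a, b, c, ha, hb, hc, H⟩ := hq
  have hlt : Computable₂ fun m n : ℕ => decide (m < n) :=
    Primrec.nat_lt.decide.to_comp
  have hra : Computable fun d => a d * r.den :=
    Primrec.nat_mul.to_comp.comp ha (Computable.const _)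
  have hrb : Computable fun d => r.num.natAbs * b d :=
    Primrec.nat_mul.to_comp.comp (Computable.const _) hb
  have habs : (r.num.natAbs : ℚ) = |r| * r.den := by
    rw [Nat.cast_natAbs, Int.cast_abs]
    have h := congrArg abs (Rat.mul_den_eq_num r)
    rw [abs_mul, Nat.abs_cast] at h
    exact h.symm
  have hden : (0 : ℚ) < r.den := by exact_mod_cast r.den_pos
  have hbpos : ∀ d, (0 : ℚ) < b d := fun d => by exact_mod_cast Nat.pos_of_ne_zero (H d).1
  have hsign : ∀ d, q d = if Nat.bodd (c d) = true then -((a d : ℚ) / b d) else a d / b d := by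
    intro d
    have hpow : ∀ n : ℕ, (-1 : ℚ) ^ n = if Nat.bodd n = true then -1 else 1 := by
      intro n
      induction n with
      | zero => simp
      | succ n ih =>
        rw [pow_succ, ih, Nat.bodd_succ]
        cases Nat.bodd n <;> simp
    rw [(H d).2, hpow]
    split_ifs <;> ring
  have hlt1 : ∀ d, a d * r.den < r.num.natAbs * b d ↔ (a d : ℚ) / b d < |r| := by
    intro d
    rw [div_lt_iff₀ (hbpos d), ← Nat.cast_lt (α := ℚ)]
    push_cast
    rw [habs, mul_right_comm, mul_lt_mul_iff_left₀ hden]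
  have hlt2 : ∀ d, r.num.natAbs * b d < a d * r.den ↔ |r| < (a d : ℚ) / b d := by
    intro d
    rw [lt_div_iff₀ (hbpos d), ← Nat.cast_lt (α := ℚ)]
    push_cast
    rw [habs, mul_right_comm, mul_lt_mul_iff_left₀ hden]
  have hnn : ∀ d, 0 ≤ (a d : ℚ) / b d := fun d => by positivity
  by_cases hr : r < 0
  · refine ((Primrec.nat_bodd.to_comp.comp hc).cond (hlt.comp hra hrb)
      (Computable.const true)).of_eq fun d => ?_
    have := hnn d
    rw [hsign d]
    cases Nat.bodd (c d)
    · simp only [cond_false, Bool.false_eq_true, if_false]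
      exact (decide_eq_true (by linarith)).symm
    · simp only [cond_true, if_true]
      rw [decide_eq_decide, hlt1, abs_of_neg hr]
      constructor <;> intro h <;> linarith
  · refine ((Primrec.nat_bodd.to_comp.comp hc).cond (Computable.const false)
      (hlt.comp hrb hra)).of_eq fun d => ?_
    have := hnn d
    rw [hsign d]
    cases Nat.bodd (c d)
    · simp only [cond_false, Bool.false_eq_true, if_false]
      rw [decide_eq_decide, hlt2, abs_of_nonneg (not_lt.1 hr)]
    · simp only [cond_true, if_true]
      exact (decide_eq_false (by linarith)).symm

theorem RecursiveRat.prod {D : Situation × Bool → ℚ} (hD : RecursiveRat D) (h0 : ∀ d, 0 ≤ D d) :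
    RecursiveRat fun s : Situation =>
      ∏ k ∈ Finset.range s.length, D (s.take k, s.getD k false) := by
  obtain ⟨a, b, c, ha, hb, hc, H⟩ := hD
  refine ⟨_, _, fun _ => 0, computable_prod ha, computable_prod hb, Computable.const 0,
    fun s => ⟨Finset.prod_ne_zero_iff.2 fun k _ => (H _).1, ?_⟩⟩
  push_cast
  rw [pow_zero, one_mul, ← Finset.prod_div_distrib]
  refine Finset.prod_congr rfl fun k _ => ?_
  rw [← abs_of_nonneg (h0 _), (H _).2, abs_mul, abs_pow, abs_neg, abs_one, one_pow, one_mul,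
    abs_of_nonneg (by positivity)]

/-! ### Semicomputable real maps -/

theorem RecursiveRat.lowerSemicomputable {q : α → ℚ} (hq : RecursiveRat q) :
    LowerSemicomputable fun d => (q d : ℝ) :=
  ⟨fun p => q p.1, hq.comp Computable.fst, fun _ _ => le_rfl, fun _ => tendsto_const_nhds⟩

theorem RecursiveRat.computableReal {q : α → ℚ} (hq : RecursiveRat q) :
    ComputableReal fun d => (q d : ℝ) := by
  refine ⟨hq.lowerSemicomputable, ?_⟩
  have h := ((RecursiveRat.const (-1)).mul hq).lowerSemicomputable
  simpa [UpperSemicomputable] using h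

/-- Lower semicomputability is preserved by recursive substitution, scaling with a non-negative
rational factor, and resetting to a rational constant on a recursive set. -/
theorem LowerSemicomputable.cond_mul {f : β → ℝ} (hf : LowerSemicomputable f) {g : α → Bool}
    (hg : Computable g) {h : α → β} (hh : Computable h) {k : ℚ} (hk : 0 ≤ k) (r : ℚ) :
    LowerSemicomputable fun d => if g d = true then (k : ℝ) * f (h d) else r := by
  obtain ⟨q, hq, hmono, hlim⟩ := hf
  refine ⟨fun p => if g p.1 = true then k * q (h p.1, p.2) else r,
    RecursiveRat.cond (hg.comp Computable.fst) ((RecursiveRat.const k).mul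
      (hq.comp ((hh.comp Computable.fst).pair Computable.snd))) (RecursiveRat.const r),
    fun d n => ?_, fun d => ?_⟩
  · dsimp only
    split_ifs
    · exact mul_le_mul_of_nonneg_left (hmono _ _) hk
    · exact le_rfl
  · dsimp only
    split_ifs
    · push_cast
      exact (hlim _).const_mul _
    · exact tendsto_const_nhds

theorem le_of_monotone_approximation {γ : Type} {f : γ → ℝ} {q : γ × ℕ → ℚ}
    (hmono : ∀ d n, q (d, n) ≤ q (d, n + 1))
    (hlim : ∀ d, Tendsto (fun n => (q (d, n) : ℝ)) atTop (𝓝 (f d))) (d : γ) (n : ℕ) :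
    (q (d, n) : ℝ) ≤ f d :=
  (monotone_nat_of_le_succ (f := fun n => (q (d, n) : ℝ))
    fun n => by exact_mod_cast hmono d n).ge_of_tendsto (hlim d) n

/-- Although `a ≤ f d` is in general undecidable, a computable real map can effectively be
separated between two rational thresholds: approximations of `f d` from below and from above
are run until the first passes `a` or the second drops under `b`. -/
theorem ComputableReal.exists_separating {f : α → ℝ} (hf : ComputableReal f) {a b : ℚ}
    (hab : a < b) :
    ∃ S : α → Bool, Computable S ∧ (∀ d, S d = true → (a : ℝ) ≤ f d) ∧
      ∀ d, S d = false → f d ≤ b := by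
  obtain ⟨⟨q, hq, qmono, qlim⟩, ⟨r, hr, rmono, rlim⟩⟩ := hf
  have hp : Computable₂ fun (d : α) (n : ℕ) => decide (a < q (d, n)) || decide (-b < r (d, n)) :=
    (Primrec.or.to_comp.comp (hq.computable_lt a) (hr.computable_lt (-b))).to₂
  have hex : ∀ d, ∃ n, (decide (a < q (d, n)) || decide (-b < r (d, n))) = true := by
    intro d
    simp only [Bool.or_eq_true, decide_eq_true_eq]
    have hab' : (a : ℝ) < b := by exact_mod_cast hab
    rcases lt_or_ge (a : ℝ) (f d) with h | h
    · obtain ⟨n, hn⟩ := ((qlim d).eventually (lt_mem_nhds h)).exists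
      exact ⟨n, Or.inl (by exact_mod_cast hn)⟩
    · have h' : ((-b : ℚ) : ℝ) < -f d := by push_cast; linarith
      obtain ⟨n, hn⟩ := ((rlim d).eventually (lt_mem_nhds h')).exists
      exact ⟨n, Or.inr (by exact_mod_cast hn)⟩
  refine ⟨fun d => decide (a < q (d, Nat.find (hex d))),
    (hq.computable_lt a).comp (Computable.id.pair (computable_find hp hex)), fun d h => ?_,
    fun d h => ?_⟩
  · have h1 : (a : ℝ) < q (d, Nat.find (hex d)) := by exact_mod_cast of_decide_eq_true h
    exact h1.le.trans (le_of_monotone_approximation qmono qlim d _)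
  · have h1 := Nat.find_spec (hex d)
    rw [show decide (a < q (d, Nat.find (hex d))) = false from h, Bool.false_or,
      decide_eq_true_eq] at h1
    have h2 : ((-b : ℚ) : ℝ) < r (d, Nat.find (hex d)) := by exact_mod_cast h1
    have h3 := le_of_monotone_approximation rmono rlim d (Nat.find (hex d))
    push_cast at h2
    linarith

end Computability

/-! ### Paths and unboundedness -/

theorem initialSegment_succ (ω : Path) (n : ℕ) :
    initialSegment ω (n + 1) = initialSegment ω n ++ [ω n] := by
  simp [initialSegment, List.range_succ]

theorem length_initialSegment (ω : Path) (n : ℕ) : (initialSegment ω n).length = n := by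
  simp [initialSegment]

theorem take_initialSegment (ω : Path) {m n : ℕ} (h : m ≤ n) :
    (initialSegment ω n).take m = initialSegment ω m := by
  rw [initialSegment, ← List.map_take, List.take_range, min_eq_left h, initialSegment]

theorem bit_nonneg (x : Bool) : 0 ≤ bit x := by cases x <;> simp [bit]

theorem bit_le_one (x : Bool) : bit x ≤ 1 := by cases x <;> simp [bit]

theorem not_unboundedOn_iff {T : Situation → ℝ} {ω : Path} :
    ¬ UnboundedOn T ω ↔ ∃ B : ℝ, ∀ᶠ n in atTop, T (initialSegment ω n) ≤ B := by
  constructor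
  · intro h
    have hlt : limsup (fun n => (T (initialSegment ω n) : EReal)) atTop < ⊤ := lt_top_iff_ne_top.2 h
    obtain ⟨B, hB, -⟩ := EReal.lt_iff_exists_real_btwn.1 hlt
    refine ⟨B, (eventually_lt_of_limsup_lt hB).mono fun n hn => ?_⟩
    exact EReal.coe_le_coe_iff.1 hn.le
  · rintro ⟨B, hB⟩ h
    have hle : limsup (fun n => (T (initialSegment ω n) : EReal)) atTop ≤ (B : EReal) :=
      limsup_le_of_le (h := hB.mono fun n hn => EReal.coe_le_coe_iff.2 hn)
    rw [UnboundedOn] at h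
    rw [h] at hle
    exact absurd hle (not_le.2 (EReal.coe_lt_top B))

/-! ### Forecasts -/

theorem lowerForecast_nonneg (φ : ForecastingSystem) (s : Situation) : 0 ≤ lowerForecast φ s :=
  (φ s).fst.2.1

theorem upperForecast_le_one (φ : ForecastingSystem) (s : Situation) : upperForecast φ s ≤ 1 :=
  (φ s).snd.2.2

theorem lowerForecast_le_upperForecast (φ : ForecastingSystem) (s : Situation) :
    lowerForecast φ s ≤ upperForecast φ s :=
  (φ s).fst_le_snd

theorem lowerForecast_le_one (φ : ForecastingSystem) (s : Situation) : lowerForecast φ s ≤ 1 :=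
  (lowerForecast_le_upperForecast φ s).trans (upperForecast_le_one φ s)

theorem upperForecast_nonneg (φ : ForecastingSystem) (s : Situation) : 0 ≤ upperForecast φ s :=
  (lowerForecast_nonneg φ s).trans (lowerForecast_le_upperForecast φ s)

theorem isTest_generated {ψ : ForecastingSystem} {D : Situation → Bool → ℝ}
    (h0 : ∀ s x, 0 ≤ D s x)
    (hD : ∀ s, ∀ p ∈ IntervalForecast.toSet (ψ s), expectation p (D s) ≤ 1) :
    IsTest ψ (generated D) := by
  refine ⟨fun s p hp => ?_, generated_nonneg h0, generated_nil D⟩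
  have h1 := hD s p hp
  have h2 := generated_nonneg h0 s
  simp only [expectation, processDifference, generated_concat] at h1 ⊢
  nlinarith

/-! ### Betting on the selected outcomes -/

/-- The numerator of `selectedAverage`: the accumulated excess of the selected outcomes. -/
def selectedExcess (S : Situation → Bool) (F : Situation → ℝ) (ω : Path) (n : ℕ) : ℝ :=
  ∑ k ∈ Finset.range n,
    bit (S (initialSegment ω k)) * (bit (ω k) - F (initialSegment ω k))

theorem selectedExcess_succ (S : Situation → Bool) (F : Situation → ℝ) (ω : Path) (n : ℕ) :
    selectedExcess S F ω (n + 1) = selectedExcess S F ω n +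
      bit (S (initialSegment ω n)) * (bit (ω n) - F (initialSegment ω n)) :=
  Finset.sum_range_succ _ _

theorem selectionCount_succ (S : Situation → Bool) (ω : Path) (n : ℕ) :
    selectionCount S ω (n + 1) = selectionCount S ω n + bit (S (initialSegment ω n)) :=
  Finset.sum_range_succ _ _

/-- The multiplier process that stakes the fraction `η` of the current capital on the next outcome
exceeding `g`, on the situations selected by `S`. A negative `η` is a bet on the opposite. -/
def betMultiplier (S : Situation → Bool) (η g : ℚ) (s : Situation) (x : Bool) : ℝ :=
  1 + η * (bit (S s) * (bit x - g))

/-- The multiplier `betMultiplier` as a function of whether the situation is selected and of the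
next outcome. -/
def betFactor (η g : ℚ) (d : Bool × Bool) : ℚ :=
  1 + η * ((if d.1 then 1 else 0) * ((if d.2 then 1 else 0) - g))

theorem cast_betFactor (S : Situation → Bool) (η g : ℚ) (s : Situation) (x : Bool) :
    (betFactor η g (S s, x) : ℝ) = betMultiplier S η g s x := by
  cases x <;> cases h : S s <;> simp [betFactor, betMultiplier, bit, h]

theorem abs_bit_mul_sub_le {g : ℝ} (g0 : 0 ≤ g) (g1 : g ≤ 1) (b x : Bool) :
    |bit b * (bit x - g)| ≤ bit b := by
  rw [abs_le]
  cases b <;> cases x <;> simp [bit] <;> constructor <;> linarith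

theorem betMultiplier_nonneg (S : Situation → Bool) {η g : ℚ} (hη : |(η : ℝ)| ≤ 1 / 4)
    (g0 : 0 ≤ g) (g1 : g ≤ 1) (s : Situation) (x : Bool) : 0 ≤ betMultiplier S η g s x := by
  have h1 := (abs_bit_mul_sub_le (g := g) (by exact_mod_cast g0) (by exact_mod_cast g1)
    (S s) x).trans (bit_le_one _)
  have h2 : |(η : ℝ) * (bit (S s) * (bit x - g))| ≤ 1 / 4 * 1 := by
    rw [abs_mul]
    exact mul_le_mul hη h1 (abs_nonneg _) (by norm_num)
  have := (abs_le.1 h2).1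
  rw [betMultiplier]
  linarith

/-- A quadratic lower bound for `log (1 + y)`, in exponential form. -/
theorem exp_le_one_add {y : ℝ} (hy : |y| ≤ 1 / 4) : Real.exp (y - 4 * y ^ 2) ≤ 1 + y := by
  obtain ⟨h1, h2⟩ := abs_le.1 hy
  have h3 : |y - 4 * y ^ 2| ≤ 1 := by rw [abs_le]; constructor <;> nlinarith
  have h4 := (abs_le.1 (Real.abs_exp_sub_one_sub_id_le h3)).2
  have h5 : (1 - 4 * y) ^ 2 ≤ 4 := by nlinarith
  have h6 : (y - 4 * y ^ 2) ^ 2 ≤ 4 * y ^ 2 := by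
    calc (y - 4 * y ^ 2) ^ 2 = y ^ 2 * (1 - 4 * y) ^ 2 := by ring
      _ ≤ y ^ 2 * 4 := mul_le_mul_of_nonneg_left h5 (sq_nonneg y)
      _ = 4 * y ^ 2 := by ring
  linarith

/-- The capital of the betting strategy grows exponentially in the accumulated excess, up to a
second-order correction. -/
theorem exp_le_generated_betMultiplier (S : Situation → Bool) (ω : Path) {η g : ℚ}
    (hη : |(η : ℝ)| ≤ 1 / 4) (g0 : 0 ≤ g) (g1 : g ≤ 1) (n : ℕ) :
    Real.exp (η * selectedExcess S (fun _ => g) ω n - 4 * (η : ℝ) ^ 2 * selectionCount S ω n) ≤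
      generated (betMultiplier S η g) (initialSegment ω n) := by
  induction n with
  | zero => simp [selectedExcess, selectionCount, initialSegment, generated]
  | succ n ih =>
    rw [initialSegment_succ, generated_concat, selectedExcess_succ, selectionCount_succ]
    set b := bit (S (initialSegment ω n)) with hb
    set y := bit (ω n) - (g : ℝ) with hy
    have h1 : |b * y| ≤ b :=
      abs_bit_mul_sub_le (by exact_mod_cast g0) (by exact_mod_cast g1) _ _
    have hb1 : b ≤ 1 := bit_le_one _
    have hb0 : 0 ≤ b := bit_nonneg _
    have h2 : |(η : ℝ) * (b * y)| ≤ 1 / 4 := by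
      rw [abs_mul]
      calc |(η : ℝ)| * |b * y| ≤ 1 / 4 * 1 :=
            mul_le_mul hη (h1.trans hb1) (abs_nonneg _) (by norm_num)
        _ = 1 / 4 := by norm_num
    have h3 : (b * y) ^ 2 ≤ b := by
      rw [← sq_abs]
      nlinarith [abs_nonneg (b * y)]
    have h4 : Real.exp (η * (b * y) - 4 * (η : ℝ) ^ 2 * b) ≤
        betMultiplier S η g (initialSegment ω n) (ω n) := by
      refine le_trans (Real.exp_le_exp.2 ?_) (exp_le_one_add h2)
      have := mul_le_mul_of_nonneg_left h3 (sq_nonneg (η : ℝ))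
      nlinarith
    calc Real.exp (η * (selectedExcess S (fun _ => g) ω n + b * y)
          - 4 * (η : ℝ) ^ 2 * (selectionCount S ω n + b))
        = Real.exp (η * selectedExcess S (fun _ => g) ω n
            - 4 * (η : ℝ) ^ 2 * selectionCount S ω n) *
          Real.exp (η * (b * y) - 4 * (η : ℝ) ^ 2 * b) := by rw [← Real.exp_add]; congr 1; ring
      _ ≤ _ := mul_le_mul ih h4 (Real.exp_pos _).le
            (generated_nonneg (betMultiplier_nonneg S hη g0 g1) _)

/-- The betting strategy yields a recursive rational test supermartingale generated by a recursive
rational multiplier process, so it is available to every notion defined by supermartingales. -/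
theorem IsRandom.not_unboundedOn_bet {R : Notion} (hR : R ≠ .CH) {ψ : ForecastingSystem} {ω : Path}
    (h : IsRandom R ψ ω) {S : Situation → Bool} (hS : Computable S) {η g : ℚ}
    (hη : |(η : ℝ)| ≤ 1 / 4) (g0 : 0 ≤ g) (g1 : g ≤ 1)
    (hg : ∀ s, S s = true → ∀ p ∈ IntervalForecast.toSet (ψ s), (η : ℝ) * (p - g) ≤ 0) :
    ¬ UnboundedOn (generated (betMultiplier S η g)) ω := by
  have hD0 := betMultiplier_nonneg S hη g0 g1
  have hT : IsTest ψ (generated (betMultiplier S η g)) := by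
    refine isTest_generated hD0 fun s p hp => ?_
    cases hs : S s
    · simp [expectation, betMultiplier, bit, hs]
    · have := hg s hs p hp
      simp only [expectation, betMultiplier, bit, hs, if_true]
      simp only [Bool.false_eq_true, if_false]
      linarith
  have hrec : RecursiveRat fun d : Situation × Bool => betFactor η g (S d.1, d.2) :=
    (RecursiveRat.of_finite (betFactor η g)).comp
      ((hS.comp Computable.fst).pair Computable.snd)
  have hnn : ∀ d : Situation × Bool, 0 ≤ betFactor η g (S d.1, d.2) := fun d => by
    have := hD0 d.1 d.2
    rw [← cast_betFactor] at this
    exact_mod_cast this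
  have hcomp : ComputableReal (generated (betMultiplier S η g)) := by
    have e : generated (betMultiplier S η g) = fun s : Situation =>
        ((∏ k ∈ Finset.range s.length,
          betFactor η g (S (s.take k), s.getD k false) : ℚ) : ℝ) := by
      funext s
      rw [generated, Rat.cast_prod]
      exact Finset.prod_congr rfl fun k _ => (cast_betFactor _ _ _ _ _).symm
    rw [e]
    exact (RecursiveRat.prod hrec hnn).computableReal
  cases R with
  | ML => exact h _ ⟨hT, hcomp.1⟩
  | wML =>
    refine h _ ⟨hT, _, hD0, ?_, rfl⟩
    simpa only [cast_betFactor] using hrec.lowerSemicomputable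
  | C => exact h _ ⟨hT, hcomp⟩
  | CH => exact absurd rfl hR

/-- Boundedness of the capital limits the excess to a proportion of the count that is of the order
of the stake. The sign of `η` decides whether this is an upper or a lower bound. -/
theorem eventually_excess_le_of_bet {R : Notion} (hR : R ≠ .CH) {ψ : ForecastingSystem} {ω : Path}
    (h : IsRandom R ψ ω) {S : Situation → Bool} (hS : Computable S)
    (hC : Tendsto (selectionCount S ω) atTop atTop) {η g : ℚ} (hη0 : η ≠ 0)
    (hη : |(η : ℝ)| ≤ 1 / 4) (g0 : 0 ≤ g) (g1 : g ≤ 1)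
    (hg : ∀ s, S s = true → ∀ p ∈ IntervalForecast.toSet (ψ s), (η : ℝ) * (p - g) ≤ 0) :
    ∀ᶠ n in atTop, η * selectedExcess S (fun _ => g) ω n ≤
      5 * (η : ℝ) ^ 2 * selectionCount S ω n := by
  obtain ⟨B, hB⟩ := not_unboundedOn_iff.1 (h.not_unboundedOn_bet hR hS hη g0 g1 hg)
  have hpos : 0 < (η : ℝ) ^ 2 := by
    have : (η : ℝ) ≠ 0 := by exact_mod_cast hη0
    positivity
  -- once the count reaches `B / η ^ 2`, the bound `B` on the capital is absorbed by `η ^ 2 * count`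
  filter_upwards [hB, hC.eventually_ge_atTop (B / (η : ℝ) ^ 2)] with n h1 h2
  have h3 := (Real.add_one_le_exp _).trans
    ((exp_le_generated_betMultiplier S ω hη g0 g1 n).trans h1)
  rw [div_le_iff₀ hpos] at h2
  linarith

/-- The stake used to detect a relative excess of `ε`. -/
theorem exists_stake {ε : ℝ} (hε : 0 < ε) :
    ∃ η : ℚ, (0 : ℝ) < η ∧ (η : ℝ) ≤ 1 / 4 ∧ 5 * (η : ℝ) ≤ ε := by
  obtain ⟨η, h1, h2⟩ := exists_rat_btwn (show (0 : ℝ) < min (1 / 4) (ε / 5) by positivity)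
  have h3 := h2.trans_le (min_le_left _ _)
  have h4 := h2.trans_le (min_le_right _ _)
  exact ⟨η, h1, h3.le, by linarith⟩

/-! ### Church randomness in terms of accumulated excesses -/

theorem selectionCount_nonneg (S : Situation → Bool) (ω : Path) (n : ℕ) :
    0 ≤ selectionCount S ω n :=
  Finset.sum_nonneg fun _ _ => bit_nonneg _

theorem selectedExcess_mono {S : Situation → Bool} {F G : Situation → ℝ}
    (h : ∀ s, S s = true → F s ≤ G s) (ω : Path) (n : ℕ) :
    selectedExcess S G ω n ≤ selectedExcess S F ω n := by
  refine Finset.sum_le_sum fun k _ => ?_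
  cases hs : S (initialSegment ω k)
  · simp [bit]
  · have := h _ hs
    simp only [bit, if_true]
    linarith

theorem abs_selectedAverage_le {S : Situation → Bool} {F : Situation → ℝ} (h0 : ∀ s, 0 ≤ F s)
    (h1 : ∀ s, F s ≤ 1) (ω : Path) (n : ℕ) : |selectedAverage S F ω n| ≤ 1 := by
  have h : |selectedExcess S F ω n| ≤ selectionCount S ω n :=
    (Finset.abs_sum_le_sum_abs _ _).trans
      (Finset.sum_le_sum fun k _ => abs_bit_mul_sub_le (h0 _) (h1 _) _ _)
  rw [selectedAverage, ← selectedExcess, abs_div, abs_of_nonneg (selectionCount_nonneg _ _ _)]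
  exact div_le_one_of_le₀ h (selectionCount_nonneg _ _ _)

/-- The real `limsup` carries its intended meaning here because the selected averages are bounded,
and the value `0` of the average before the first selection does not affect it. -/
theorem limsup_selectedAverage_nonpos_iff {S : Situation → Bool} {F : Situation → ℝ}
    (h0 : ∀ s, 0 ≤ F s) (h1 : ∀ s, F s ≤ 1) {ω : Path}
    (hC : Tendsto (selectionCount S ω) atTop atTop) :
    limsup (selectedAverage S F ω) atTop ≤ 0 ↔
      ∀ ε > 0, ∀ᶠ n in atTop, selectedExcess S F ω n ≤ ε * selectionCount S ω n := by
  have hb := fun n => abs_le.1 (abs_selectedAverage_le (S := S) h0 h1 ω n)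
  have hle : IsBoundedUnder (· ≤ ·) atTop (selectedAverage S F ω) :=
    isBoundedUnder_of ⟨1, fun n => (hb n).2⟩
  have hge : IsBoundedUnder (· ≥ ·) atTop (selectedAverage S F ω) :=
    isBoundedUnder_of ⟨-1, fun n => (hb n).1⟩
  constructor
  · intro h ε hε
    filter_upwards [eventually_lt_of_limsup_lt (h.trans_lt hε) hle,
      hC.eventually_gt_atTop 0] with n hn hpos
    exact ((div_lt_iff₀ hpos).1 hn).le
  · intro h
    refine le_of_forall_pos_le_add fun ε hε => ?_
    rw [zero_add]
    refine limsup_le_of_le hge.isCoboundedUnder_le ?_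
    filter_upwards [h ε hε, hC.eventually_gt_atTop 0] with n hn hpos
    exact (div_le_iff₀ hpos).2 hn

theorem liminf_selectedAverage_nonneg_iff {S : Situation → Bool} {F : Situation → ℝ}
    (h0 : ∀ s, 0 ≤ F s) (h1 : ∀ s, F s ≤ 1) {ω : Path}
    (hC : Tendsto (selectionCount S ω) atTop atTop) :
    0 ≤ liminf (selectedAverage S F ω) atTop ↔
      ∀ ε > 0, ∀ᶠ n in atTop, -(ε * selectionCount S ω n) ≤ selectedExcess S F ω n := by
  have hb := fun n => abs_le.1 (abs_selectedAverage_le (S := S) h0 h1 ω n)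
  have hle : IsBoundedUnder (· ≤ ·) atTop (selectedAverage S F ω) :=
    isBoundedUnder_of ⟨1, fun n => (hb n).2⟩
  have hge : IsBoundedUnder (· ≥ ·) atTop (selectedAverage S F ω) :=
    isBoundedUnder_of ⟨-1, fun n => (hb n).1⟩
  constructor
  · intro h ε hε
    filter_upwards [eventually_lt_of_lt_liminf ((neg_lt_zero.2 hε).trans_le h) hge,
      hC.eventually_gt_atTop 0] with n hn hpos
    have := ((lt_div_iff₀ hpos).1 hn).le
    rwa [neg_mul] at this
  · intro h
    refine le_of_forall_pos_le_add fun ε hε => ?_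
    suffices -ε ≤ liminf (selectedAverage S F ω) atTop by linarith
    refine le_liminf_of_le hle.isCoboundedUnder_ge ?_
    filter_upwards [h ε hε, hC.eventually_gt_atTop 0] with n hn hpos
    refine (le_div_iff₀ hpos).2 ?_
    rwa [neg_mul]

/-- For each of the randomness notions, the selected outcomes of a random path do not exceed on
average a rational number that dominates the selected forecasts. -/
theorem IsRandom.eventually_excess_le {R : Notion} {ψ : ForecastingSystem} {ω : Path}
    (h : IsRandom R ψ ω) {S : Situation → Bool} (hS : Computable S)
    (hC : Tendsto (selectionCount S ω) atTop atTop) {g : ℚ} (g0 : 0 ≤ g) (g1 : g ≤ 1)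
    (hg : ∀ s, S s = true → upperForecast ψ s ≤ g) {ε : ℝ} (hε : 0 < ε) :
    ∀ᶠ n in atTop, selectedExcess S (fun _ => g) ω n ≤ ε * selectionCount S ω n := by
  by_cases hR : R = .CH
  · subst hR
    filter_upwards [(limsup_selectedAverage_nonpos_iff (upperForecast_nonneg ψ)
      (upperForecast_le_one ψ) hC).1 (h S hS hC).2 ε hε] with n hn
    exact (selectedExcess_mono hg ω n).trans hn
  · obtain ⟨η, h0, h1, h2⟩ := exists_stake hε
    have hη0 : η ≠ 0 := by rintro rfl; simp at h0
    filter_upwards [eventually_excess_le_of_bet hR h hS hC hη0 (by rwa [abs_of_pos h0]) g0 g1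
      fun s hs p hp => mul_nonpos_of_nonneg_of_nonpos h0.le
        (sub_nonpos.2 (hp.2.trans (hg s hs)))] with n hn
    have h3 : (η : ℝ) * selectedExcess S (fun _ => g) ω n ≤ η * (5 * η * selectionCount S ω n) := by
      linarith
    exact (le_of_mul_le_mul_left h3 h0).trans
      (mul_le_mul_of_nonneg_right h2 (selectionCount_nonneg _ _ _))

/-- For each of the randomness notions, the selected outcomes of a random path do not fall on
average below a rational number that is dominated by the selected forecasts. -/
theorem IsRandom.eventually_le_excess {R : Notion} {ψ : ForecastingSystem} {ω : Path}
    (h : IsRandom R ψ ω) {S : Situation → Bool} (hS : Computable S)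
    (hC : Tendsto (selectionCount S ω) atTop atTop) {g : ℚ} (g0 : 0 ≤ g) (g1 : g ≤ 1)
    (hg : ∀ s, S s = true → (g : ℝ) ≤ lowerForecast ψ s) {ε : ℝ} (hε : 0 < ε) :
    ∀ᶠ n in atTop, -(ε * selectionCount S ω n) ≤ selectedExcess S (fun _ => g) ω n := by
  by_cases hR : R = .CH
  · subst hR
    filter_upwards [(liminf_selectedAverage_nonneg_iff (lowerForecast_nonneg ψ)
      (lowerForecast_le_one ψ) hC).1 (h S hS hC).1 ε hε] with n hn
    exact hn.trans (selectedExcess_mono hg ω n)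
  · obtain ⟨η, h0, h1, h2⟩ := exists_stake hε
    have hη0 : -η ≠ 0 := by rintro h; simp [neg_eq_zero.1 h] at h0
    have hη : |((-η : ℚ) : ℝ)| ≤ 1 / 4 := by rwa [Rat.cast_neg, abs_neg, abs_of_pos h0]
    filter_upwards [eventually_excess_le_of_bet hR h hS hC hη0 hη g0 g1
      fun s hs p hp => by
        rw [Rat.cast_neg]
        exact mul_nonpos_of_nonpos_of_nonneg (by linarith)
          (sub_nonneg.2 ((hg s hs).trans hp.1))] with n hn
    rw [Rat.cast_neg] at hn
    have h3 : (η : ℝ) * -selectedExcess S (fun _ => g) ω n ≤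
        η * (5 * η * selectionCount S ω n) := by linarith
    have := (le_of_mul_le_mul_left h3 h0).trans
      (mul_le_mul_of_nonneg_right h2 (selectionCount_nonneg S ω n))
    linarith

/-- Every notion of randomness is at least as strong as Church randomness, for stationary
forecasts with rational bounds. -/
theorem IsRandom.churchRandom_stationary {R : Notion} {I : IntervalForecast} {a b : ℚ}
    (ha : IntervalForecast.lo I = a) (hb : IntervalForecast.hi I = b) {ω : Path}
    (h : IsRandom R (stationary I) ω) : IsRandom .CH (stationary I) ω := by
  have hlo : lowerForecast (stationary I) = fun _ => (a : ℝ) := funext fun _ => ha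
  have hhi : upperForecast (stationary I) = fun _ => (b : ℝ) := funext fun _ => hb
  have a0 : (0 : ℝ) ≤ a := ha ▸ lowerForecast_nonneg (stationary I) []
  have a1 : (a : ℝ) ≤ 1 := ha ▸ lowerForecast_le_one (stationary I) []
  have b0 : (0 : ℝ) ≤ b := hb ▸ upperForecast_nonneg (stationary I) []
  have b1 : (b : ℝ) ≤ 1 := hb ▸ upperForecast_le_one (stationary I) []
  intro S hS hC
  rw [liminf_selectedAverage_nonneg_iff (lowerForecast_nonneg _) (lowerForecast_le_one _) hC,
    limsup_selectedAverage_nonpos_iff (upperForecast_nonneg _) (upperForecast_le_one _) hC]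
  rw [hlo, hhi]
  exact ⟨fun ε hε => h.eventually_le_excess hS hC (by exact_mod_cast a0) (by exact_mod_cast a1)
      (fun _ _ => by rw [hlo]) hε,
    fun ε hε => h.eventually_excess_le hS hC (by exact_mod_cast b0) (by exact_mod_cast b1)
      (fun _ _ => by rw [hhi]) hε⟩

/-! ### Stopping a supermartingale -/

/-- The longest initial segment of `s` all of whose proper initial segments satisfy `ok`. -/
def stopAt (ok : Situation → Bool) (s : Situation) : Situation :=
  List.reverseRecOn s [] fun s x t => if t = s ∧ ok s = true then s ++ [x] else t

theorem stopAt_nil (ok : Situation → Bool) : stopAt ok [] = [] := by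
  simp [stopAt]

theorem stopAt_concat (ok : Situation → Bool) (s : Situation) (x : Bool) :
    stopAt ok (s ++ [x]) =
      if stopAt ok s = s ∧ ok s = true then s ++ [x] else stopAt ok s := by
  rw [stopAt, List.reverseRecOn_concat]
  rfl

theorem computable_decide_eq {α β : Type} [Primcodable α] [Primcodable β] [DecidableEq β]
    {f g : α → β} (hf : Computable f) (hg : Computable g) :
    Computable fun a => decide (f a = g a) :=
  Primrec.eq.decide.to_comp.comp hf hg

theorem computable_stopAt {ok : Situation → Bool} (hok : Computable ok) :
    Computable (stopAt ok) := by
  refine computable_of_concat (h := fun p =>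
    bif decide (p.2.1 = p.1) && ok p.1 then p.1 ++ [p.2.2] else p.2.1) ?_ fun s x => ?_
  · have h1 : Computable fun p : Situation × Situation × Bool => p.2.1 :=
      Computable.fst.comp Computable.snd
    exact (Primrec.and.to_comp.comp (computable_decide_eq h1 Computable.fst)
      (hok.comp Computable.fst)).cond
      (Computable.list_concat.comp Computable.fst (Computable.snd.comp Computable.snd)) h1
  · rw [stopAt_concat]
    simp [cond_eq_ite]

/-- The condition `ok`, imposed only on situations at least as long as `w`. -/
def okFrom (w : Situation) (ok : Situation → Bool) (s : Situation) : Bool :=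
  decide (s.length < w.length) || ok s

theorem okFrom_of_length_le {w s : Situation} (ok : Situation → Bool) (h : w.length ≤ s.length) :
    okFrom w ok s = ok s := by
  simp [okFrom, h]

theorem okFrom_of_length_lt {w s : Situation} (ok : Situation → Bool) (h : s.length < w.length) :
    okFrom w ok s = true := by
  simp [okFrom, h]

theorem computable_okFrom (w : Situation) {ok : Situation → Bool} (hok : Computable ok) :
    Computable (okFrom w ok) :=
  Primrec.or.to_comp.comp
    (Primrec.nat_lt.decide.to_comp.comp Computable.list_length (Computable.const _)) hok

theorem stopAt_okFrom_of_length_le {w : Situation} (ok : Situation → Bool) (s : Situation)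
    (h : s.length ≤ w.length) : stopAt (okFrom w ok) s = s := by
  induction s using List.reverseRecOn with
  | nil => exact stopAt_nil _
  | append_singleton s x ih =>
    rw [List.length_append, List.length_singleton] at h
    rw [stopAt_concat, if_pos ⟨ih (by omega), okFrom_of_length_lt ok (by omega)⟩]

/-- The process that has value `1` in situations that do not extend `w`, that follows `T / c` from
`w` on as long as `ok` holds, and that is frozen when `ok` fails. -/
noncomputable def followFrom (w : Situation) (ok : Situation → Bool) (c : ℝ) (T : Situation → ℝ)
    (s : Situation) : ℝ :=
  if s.take w.length = w then c⁻¹ * T (stopAt (okFrom w ok) s) else 1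

theorem take_concat_eq_iff {w s : Situation} (h : w.length ≤ s.length) (x : Bool) :
    (s ++ [x]).take w.length = w ↔ s.take w.length = w := by
  rw [List.take_append_of_le_length h]

theorem not_take_eq {w s : Situation} (h : s.length < w.length) : s.take w.length ≠ w := by
  intro e
  rw [List.take_of_length_le h.le] at e
  rw [e] at h
  exact lt_irrefl _ h

theorem eq_of_take_concat_eq {w s : Situation} (h : s.length < w.length) {x : Bool}
    (e : (s ++ [x]).take w.length = w) : s ++ [x] = w := by
  rwa [List.take_of_length_le (by simpa using h)] at e

theorem followFrom_of_length_lt {w s : Situation} (ok : Situation → Bool) (c : ℝ)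
    (T : Situation → ℝ) (h : s.length < w.length) : followFrom w ok c T s = 1 :=
  if_neg (not_take_eq h)

/-- The situations in which `followFrom` moves along with `T`. -/
def follows (w : Situation) (ok : Situation → Bool) (s : Situation) : Bool :=
  decide (s.take w.length = w) && (decide (stopAt (okFrom w ok) s = s) && ok s)

theorem follows_iff {w : Situation} {ok : Situation → Bool} {s : Situation} :
    follows w ok s = true ↔
      s.take w.length = w ∧ stopAt (okFrom w ok) s = s ∧ ok s = true := by
  simp [follows]

theorem followFrom_of_follows {w : Situation} {ok : Situation → Bool} (c : ℝ)
    (T : Situation → ℝ) {s : Situation} (h : follows w ok s = true) :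
    followFrom w ok c T s = c⁻¹ * T s ∧
      ∀ x, followFrom w ok c T (s ++ [x]) = c⁻¹ * T (s ++ [x]) := by
  obtain ⟨h1, h2, h3⟩ := follows_iff.1 h
  have hl : w.length ≤ s.length := le_of_not_gt fun hl => not_take_eq hl h1
  refine ⟨by rw [followFrom, if_pos h1, h2], fun x => ?_⟩
  rw [followFrom, if_pos ((take_concat_eq_iff hl x).2 h1), stopAt_concat,
    if_pos ⟨h2, by rwa [okFrom_of_length_le ok hl]⟩]

theorem followFrom_concat_of_not_follows {w : Situation} {ok : Situation → Bool} (c : ℝ)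
    (T : Situation → ℝ) {s : Situation} (hl : w.length ≤ s.length) (h : ¬ follows w ok s = true)
    (x : Bool) : followFrom w ok c T (s ++ [x]) = followFrom w ok c T s := by
  by_cases h1 : s.take w.length = w
  · rw [followFrom, if_pos ((take_concat_eq_iff hl x).2 h1), followFrom, if_pos h1, stopAt_concat,
      okFrom_of_length_le ok hl, if_neg fun h2 => h (follows_iff.2 ⟨h1, h2⟩)]
  · rw [followFrom, if_neg (mt (take_concat_eq_iff hl x).1 h1), followFrom, if_neg h1]

theorem followFrom_concat_of_length_lt {w : Situation} (ok : Situation → Bool) (c : ℝ)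
    (T : Situation → ℝ) {s : Situation} (hl : s.length < w.length) (x : Bool) :
    followFrom w ok c T (s ++ [x]) = if s ++ [x] = w then c⁻¹ * T w else 1 := by
  split_ifs with h
  · rw [followFrom, h, if_pos (List.take_length), stopAt_okFrom_of_length_le ok w le_rfl]
  · rw [followFrom, if_neg fun e => h (eq_of_take_concat_eq hl e)]

/-- If `ok` guarantees that the forecasts of `φ` are at least as informative as those of `ψ`, then
following a test supermartingale for `ψ` while `ok` holds gives one for `φ`. -/
theorem isTest_followFrom {φ ψ : ForecastingSystem} {ok : Situation → Bool}
    (hok : ∀ s, ok s = true →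
      IntervalForecast.toSet (φ s) ⊆ IntervalForecast.toSet (ψ s))
    {T : Situation → ℝ} (hT : IsTest ψ T) {w : Situation} (hw : w ≠ []) {c : ℝ} (hc : 0 < c)
    (hTw : T w ≤ c) : IsTest φ (followFrom w ok c T) := by
  obtain ⟨hsup, hnn, -⟩ := hT
  refine ⟨fun s p hp => ?_, fun s => ?_, followFrom_of_length_lt ok c T ?_⟩
  · simp only [expectation, processDifference]
    have hp0 : 0 ≤ p := (lowerForecast_nonneg φ s).trans hp.1
    have hp1 : p ≤ 1 := hp.2.trans (upperForecast_le_one φ s)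
    rcases lt_or_ge s.length w.length with hl | hl
    · have hle : ∀ x, followFrom w ok c T (s ++ [x]) ≤ 1 := fun x => by
        rw [followFrom_concat_of_length_lt ok c T hl]
        split_ifs
        · exact (inv_mul_le_one₀ hc).2 hTw
        · exact le_rfl
      rw [followFrom_of_length_lt ok c T hl]
      nlinarith [hle true, hle false]
    · by_cases h : follows w ok s = true
      · obtain ⟨h1, h2⟩ := followFrom_of_follows c T h
        have h3 := hsup s p (hok s (follows_iff.1 h).2.2 hp)
        simp only [expectation, processDifference] at h3
        rw [h1, h2, h2]
        have := mul_nonpos_of_nonneg_of_nonpos (inv_nonneg.2 hc.le) h3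
        linarith
      · simp [followFrom_concat_of_not_follows c T hl h]
  · rw [followFrom]
    split_ifs
    · exact mul_nonneg (inv_nonneg.2 hc.le) (hnn _)
    · exact zero_le_one
  · exact List.length_pos_of_ne_nil hw

/-- If `T` is generated by `D`, following `T` is generated by the multiplier process that agrees
with `D` where `T` is followed and equals `1` elsewhere. -/
theorem followFrom_generated {w : Situation} (ok : Situation → Bool) {D : Situation → Bool → ℝ}
    (hw : w ≠ []) (hpos : 0 < generated D w) :
    followFrom w ok (generated D w) (generated D) =
      generated fun s x => if follows w ok s = true then D s x else 1 := by
  funext s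
  induction s using List.reverseRecOn with
  | nil =>
    rw [generated_nil, followFrom_of_length_lt]
    exact List.length_pos_of_ne_nil hw
  | append_singleton s x ih =>
    rw [generated_concat, ← ih]
    rcases lt_or_ge s.length w.length with hl | hl
    · rw [followFrom_concat_of_length_lt ok _ _ hl, followFrom_of_length_lt ok _ _ hl,
        inv_mul_cancel₀ hpos.ne', ite_self,
        if_neg fun h => not_take_eq hl (follows_iff.1 h).1, mul_one]
    · split_ifs with h
      · obtain ⟨h1, h2⟩ := followFrom_of_follows (generated D w) (generated D) h
        rw [h1, h2, generated_concat, mul_assoc]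
      · rw [followFrom_concat_of_not_follows _ _ hl h, mul_one]

theorem computable_take_eq (w : Situation) :
    Computable fun s : Situation => decide (s.take w.length = w) :=
  computable_decide_eq (Primrec.list_take.to_comp.comp (Computable.const _) Computable.id)
    (Computable.const _)

theorem computable_follows (w : Situation) {ok : Situation → Bool} (hok : Computable ok) :
    Computable (follows w ok) :=
  Primrec.and.to_comp.comp (computable_take_eq w) (Primrec.and.to_comp.comp
    (computable_decide_eq (computable_stopAt (computable_okFrom w hok)) Computable.id) hok)

theorem LowerSemicomputable.followFrom {T : Situation → ℝ} (hT : LowerSemicomputable T)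
    (w : Situation) {ok : Situation → Bool} (hok : Computable ok) {c : ℚ} (hc : 0 < c) :
    LowerSemicomputable (followFrom w ok c T) := by
  have h := hT.cond_mul (computable_take_eq w) (computable_stopAt (computable_okFrom w hok))
    (inv_nonneg.2 hc.le) 1
  convert h using 2 with s
  simp [ImpreciseRandomness.followFrom]

theorem UpperSemicomputable.followFrom {T : Situation → ℝ} (hT : UpperSemicomputable T)
    (w : Situation) {ok : Situation → Bool} (hok : Computable ok) {c : ℚ} (hc : 0 < c) :
    UpperSemicomputable (followFrom w ok c T) := by
  have h := LowerSemicomputable.cond_mul (f := fun s => -T s) hT (computable_take_eq w)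
    (computable_stopAt (computable_okFrom w hok)) (inv_nonneg.2 hc.le) (-1)
  unfold UpperSemicomputable
  convert h using 2 with s
  simp only [ImpreciseRandomness.followFrom, decide_eq_true_eq]
  split_ifs <;> simp

theorem stopAt_initialSegment {ω : Path} {ok : Situation → Bool} {N : ℕ}
    (hN : ∀ n ≥ N, ok (initialSegment ω n) = true) (n : ℕ) :
    stopAt (okFrom (initialSegment ω N) ok) (initialSegment ω n) = initialSegment ω n := by
  induction n with
  | zero => exact stopAt_nil _
  | succ n ih =>
    rw [initialSegment_succ, stopAt_concat, if_pos]
    refine ⟨ih, ?_⟩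
    rcases lt_or_ge n N with h | h
    · exact okFrom_of_length_lt _ (by simpa [length_initialSegment] using h)
    · rw [okFrom_of_length_le _ (by simpa [length_initialSegment] using h), hN n h]

theorem not_unboundedOn_of_followFrom {ω : Path} {ok : Situation → Bool} {N : ℕ}
    (hN : ∀ n ≥ N, ok (initialSegment ω n) = true) {c : ℝ} (hc : 0 < c) {T : Situation → ℝ}
    (h : ¬ UnboundedOn (followFrom (initialSegment ω N) ok c T) ω) : ¬ UnboundedOn T ω := by
  rw [not_unboundedOn_iff] at h ⊢
  obtain ⟨B, hB⟩ := h
  refine ⟨c * B, ?_⟩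
  filter_upwards [hB, eventually_ge_atTop N] with n h1 h2
  rw [followFrom, length_initialSegment, take_initialSegment ω h2, if_pos rfl,
    stopAt_initialSegment hN] at h1
  exact (inv_mul_le_iff₀ hc).1 h1

theorem generated_initialSegment_eq_zero {D : Situation → Bool → ℝ} {ω : Path} {N : ℕ}
    (h : generated D (initialSegment ω N) = 0) {n : ℕ} (hn : N ≤ n) :
    generated D (initialSegment ω n) = 0 := by
  induction n, hn using Nat.le_induction with
  | base => exact h
  | succ n _ ih => rw [initialSegment_succ, generated_concat, ih, zero_mul]

/-! ### Transfer between forecasting systems -/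

theorem selectedExcess_le_add {S : Situation → Bool} {F G : Situation → ℝ} {ω : Path} {N : ℕ}
    (h1 : ∀ k, F (initialSegment ω k) - G (initialSegment ω k) ≤ 1)
    (hN : ∀ k ≥ N, F (initialSegment ω k) ≤ G (initialSegment ω k)) (n : ℕ) :
    selectedExcess S G ω n ≤ selectedExcess S F ω n + N := by
  have key : ∀ n, selectedExcess S G ω n ≤ selectedExcess S F ω n + (min n N : ℕ) := by
    intro n
    induction n with
    | zero => simp [selectedExcess]
    | succ n ih =>
      rw [selectedExcess_succ, selectedExcess_succ]
      have hb0 := bit_nonneg (S (initialSegment ω n))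
      have hb1 := bit_le_one (S (initialSegment ω n))
      rcases lt_or_ge n N with h | h
      · rw [min_eq_left h.le] at ih
        rw [min_eq_left (Nat.succ_le_of_lt h)]
        push_cast
        nlinarith [h1 n]
      · rw [min_eq_right h] at ih
        rw [min_eq_right (h.trans n.le_succ)]
        nlinarith [hN n h]
  refine (key n).trans ?_
  gcongr
  exact min_le_right _ _

/-- Randomness for `φ` implies randomness for `ψ` if, along the path, the forecasts of `φ` are
eventually recognised by a recursive condition to be contained in those of `ψ`. -/
theorem IsRandom.of_eventually_subset {R : Notion} {φ ψ : ForecastingSystem} {ω : Path}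
    (h : IsRandom R φ ω) {ok : Situation → Bool} (hcomp : Computable ok)
    (hlo : ∀ s, ok s = true → lowerForecast ψ s ≤ lowerForecast φ s)
    (hhi : ∀ s, ok s = true → upperForecast φ s ≤ upperForecast ψ s)
    (hev : ∀ᶠ n in atTop, ok (initialSegment ω n) = true) : IsRandom R ψ ω := by
  obtain ⟨N, hN1, hN⟩ : ∃ N ≥ 1, ∀ n ≥ N, ok (initialSegment ω n) = true := by
    obtain ⟨N, hN⟩ := eventually_atTop.1 hev
    exact ⟨max N 1, le_max_right _ _, fun n hn => hN n ((le_max_left _ _).trans hn)⟩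
  have hw : initialSegment ω N ≠ [] := by
    rw [← List.length_pos_iff, length_initialSegment]
    exact hN1
  have hsub : ∀ s, ok s = true →
      IntervalForecast.toSet (φ s) ⊆ IntervalForecast.toSet (ψ s) :=
    fun s hs => Set.Icc_subset_Icc (hlo s hs) (hhi s hs)
  -- a rational scaling factor, so that the scaled process remains semicomputable
  have hscale : ∀ T : Situation → ℝ, ∃ c : ℚ, 0 < c ∧ T (initialSegment ω N) ≤ c := fun T => by
    obtain ⟨c, hc⟩ := exists_rat_gt (max 0 (T (initialSegment ω N)))
    exact ⟨c, by exact_mod_cast (le_max_left _ _).trans_lt hc, (le_max_right _ _).trans hc.le⟩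
  cases R with
  | ML =>
    rintro T ⟨hT, hT1⟩
    obtain ⟨c, hc, hTc⟩ := hscale T
    exact not_unboundedOn_of_followFrom hN (by exact_mod_cast hc)
      (h _ ⟨isTest_followFrom hsub hT hw (by exact_mod_cast hc) hTc, hT1.followFrom _ hcomp hc⟩)
  | wML =>
    rintro T ⟨hT, D, hD0, hD, rfl⟩
    -- an exact scaling factor, real and possibly not computable: it cancels in the multipliers
    rcases (generated_nonneg hD0 (initialSegment ω N)).eq_or_lt with h0 | hpos
    · refine not_unboundedOn_iff.2 ⟨0, ?_⟩
      filter_upwards [eventually_ge_atTop N] with n hn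
      exact (generated_initialSegment_eq_zero h0.symm hn).le
    · refine not_unboundedOn_of_followFrom hN hpos
        (h _ ⟨isTest_followFrom hsub hT hw hpos le_rfl, _, fun s x => ?_, ?_,
          followFrom_generated ok hw hpos⟩)
      · split_ifs
        · exact hD0 s x
        · exact zero_le_one
      · simpa using hD.cond_mul ((computable_follows (initialSegment ω N) hcomp).comp
          Computable.fst) Computable.id zero_le_one 1
  | C =>
    rintro T ⟨hT, hT1, hT2⟩
    obtain ⟨c, hc, hTc⟩ := hscale T
    exact not_unboundedOn_of_followFrom hN (by exact_mod_cast hc)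
      (h _ ⟨isTest_followFrom hsub hT hw (by exact_mod_cast hc) hTc, hT1.followFrom _ hcomp hc,
        hT2.followFrom _ hcomp hc⟩)
  | CH =>
    intro S hS hC
    obtain ⟨h1, h2⟩ := h S hS hC
    rw [liminf_selectedAverage_nonneg_iff (lowerForecast_nonneg _) (lowerForecast_le_one _) hC]
      at h1 ⊢
    rw [limsup_selectedAverage_nonpos_iff (upperForecast_nonneg _) (upperForecast_le_one _) hC]
      at h2 ⊢
    constructor
    · intro ε hε
      filter_upwards [h1 (ε / 2) (half_pos hε), hC.eventually_ge_atTop (N / (ε / 2))] with n e1 e2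
      have e3 := selectedExcess_le_add (S := S) (F := lowerForecast ψ) (G := lowerForecast φ)
        (ω := ω) (N := N)
        (fun k => by linarith [lowerForecast_le_one ψ (initialSegment ω k),
          lowerForecast_nonneg φ (initialSegment ω k)])
        (fun k hk => hlo _ (hN k hk)) n
      rw [div_le_iff₀ (half_pos hε)] at e2
      linarith
    · intro ε hε
      filter_upwards [h2 (ε / 2) (half_pos hε), hC.eventually_ge_atTop (N / (ε / 2))] with n e1 e2
      have e3 := selectedExcess_le_add (S := S) (F := upperForecast φ) (G := upperForecast ψ)
        (ω := ω) (N := N)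
        (fun k => by linarith [upperForecast_le_one φ (initialSegment ω k),
          upperForecast_nonneg ψ (initialSegment ω k)])
        (fun k hk => hhi _ (hN k hk)) n
      rw [div_le_iff₀ (half_pos hε)] at e2
      linarith

/-! ### The interval of forecasts along the path -/

section Bounded

variable (φ : ForecastingSystem) (ω : Path)

theorem isBoundedUnder_le_lowerForecast :
    IsBoundedUnder (· ≤ ·) atTop fun n => lowerForecast φ (initialSegment ω n) :=
  isBoundedUnder_of ⟨1, fun _ => lowerForecast_le_one _ _⟩

theorem isBoundedUnder_ge_lowerForecast :
    IsBoundedUnder (· ≥ ·) atTop fun n => lowerForecast φ (initialSegment ω n) :=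
  isBoundedUnder_of ⟨0, fun _ => lowerForecast_nonneg _ _⟩

theorem isBoundedUnder_le_upperForecast :
    IsBoundedUnder (· ≤ ·) atTop fun n => upperForecast φ (initialSegment ω n) :=
  isBoundedUnder_of ⟨1, fun _ => upperForecast_le_one _ _⟩

theorem isBoundedUnder_ge_upperForecast :
    IsBoundedUnder (· ≥ ·) atTop fun n => upperForecast φ (initialSegment ω n) :=
  isBoundedUnder_of ⟨0, fun _ => upperForecast_nonneg _ _⟩

end Bounded

/-- A path that is random for a computable forecasting system is random for a stationary forecast
with rational bounds that exceeds the interval of forecasts along the path by as little as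
desired. -/
theorem IsRandom.exists_stationary {R : Notion} {φ : ForecastingSystem} {ω : Path}
    (h : IsRandom R φ ω) (hcomp : IsComputable φ) {x y : ℝ}
    (hx : x < liminf (fun n => lowerForecast φ (initialSegment ω n)) atTop)
    (hy : limsup (fun n => upperForecast φ (initialSegment ω n)) atTop < y) :
    ∃ (I : IntervalForecast) (a b : ℚ), IntervalForecast.lo I = a ∧ IntervalForecast.hi I = b ∧
      x ≤ IntervalForecast.lo I ∧ IntervalForecast.hi I ≤ y ∧ IsRandom R (stationary I) ω := by
  -- thresholds `x < a < a' < liminf` and `limsup < b' < b < y`; the gaps allow a recursive test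
  obtain ⟨a', ha', hal⟩ := exists_rat_btwn hx
  obtain ⟨a, hxa, haa⟩ := exists_rat_btwn ha'
  obtain ⟨b', hbu, hb'⟩ := exists_rat_btwn hy
  obtain ⟨b, hbb, hby⟩ := exists_rat_btwn hb'
  obtain ⟨S, hS, hS1, hS2⟩ := hcomp.1.exists_separating (a := a) (b := a') (by exact_mod_cast haa)
  obtain ⟨U, hU, hU1, hU2⟩ := hcomp.2.exists_separating (a := b') (b := b) (by exact_mod_cast hbb)
  have hok : Computable fun s => S s && !U s :=
    Primrec.and.to_comp.comp hS (Primrec.not.to_comp.comp hU)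
  have hlo : ∀ s, (S s && !U s) = true → ((max 0 a : ℚ) : ℝ) ≤ lowerForecast φ s := by
    intro s hs
    simp only [Bool.and_eq_true, Bool.not_eq_true'] at hs
    push_cast
    exact max_le (lowerForecast_nonneg φ s) (hS1 s hs.1)
  have hhi : ∀ s, (S s && !U s) = true → upperForecast φ s ≤ ((min 1 b : ℚ) : ℝ) := by
    intro s hs
    simp only [Bool.and_eq_true, Bool.not_eq_true'] at hs
    push_cast
    exact le_min (upperForecast_le_one φ s) (hU2 s hs.2)
  have hev : ∀ᶠ n in atTop,
      (S (initialSegment ω n) && !U (initialSegment ω n)) = true := by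
    filter_upwards [eventually_lt_of_lt_liminf hal (isBoundedUnder_ge_lowerForecast φ ω),
      eventually_lt_of_limsup_lt hbu (isBoundedUnder_le_upperForecast φ ω)] with n h1 h2
    have e1 : S (initialSegment ω n) = true := by
      by_contra e
      exact absurd (hS2 _ (by simpa using e)) (not_le.2 h1)
    have e2 : U (initialSegment ω n) = false := by
      by_contra e
      exact absurd (hU1 _ (by simpa using e)) (not_le.2 h2)
    rw [e1, e2]
    rfl
  -- the two bounds are in the right order because both hold in a situation that passes the condition
  obtain ⟨n, hn⟩ := hev.exists
  have h0 : (0 : ℝ) ≤ ((max 0 a : ℚ) : ℝ) := by exact_mod_cast le_max_left 0 a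
  have h1 : ((min 1 b : ℚ) : ℝ) ≤ 1 := by exact_mod_cast min_le_left 1 b
  have hab : ((max 0 a : ℚ) : ℝ) ≤ ((min 1 b : ℚ) : ℝ) :=
    (hlo _ hn).trans ((lowerForecast_le_upperForecast _ _).trans (hhi _ hn))
  let I : IntervalForecast :=
    ⟨(⟨((max 0 a : ℚ) : ℝ), h0, hab.trans h1⟩, ⟨((min 1 b : ℚ) : ℝ), h0.trans hab, h1⟩), hab⟩
  refine ⟨I, max 0 a, min 1 b, rfl, rfl, ?_, ?_,
    h.of_eventually_subset (ψ := stationary I) hok hlo hhi hev⟩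
  · have : (a : ℝ) ≤ ((max 0 a : ℚ) : ℝ) := by exact_mod_cast le_max_right 0 a
    exact hxa.le.trans this
  · have : ((min 1 b : ℚ) : ℝ) ≤ b := by exact_mod_cast min_le_right 1 b
    exact this.trans hby.le

theorem tendsto_selectionCount {S : Situation → Bool} {ω : Path}
    (h : ∃ᶠ n in atTop, S (initialSegment ω n) = true) :
    Tendsto (selectionCount S ω) atTop atTop := by
  have hmono : Monotone (selectionCount S ω) := monotone_nat_of_le_succ fun n => by
    rw [selectionCount_succ]
    linarith [bit_nonneg (S (initialSegment ω n))]
  refine tendsto_atTop_atTop_of_monotone hmono fun B => ?_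
  obtain ⟨m, hm⟩ := exists_nat_ge B
  suffices ∀ m : ℕ, ∃ n, (m : ℝ) ≤ selectionCount S ω n by
    obtain ⟨n, hn⟩ := this m
    exact ⟨n, hm.trans hn⟩
  intro m
  induction m with
  | zero => exact ⟨0, by simp [selectionCount]⟩
  | succ m ih =>
    obtain ⟨n, hn⟩ := ih
    obtain ⟨k, hk, hSk⟩ := (frequently_atTop.1 h) n
    refine ⟨k + 1, ?_⟩
    rw [selectionCount_succ, hSk]
    push_cast
    have := hmono hk
    simp only [bit, if_true]
    linarith

theorem selectedExcess_const_sub (S : Situation → Bool) (ω : Path) (x y : ℝ) (n : ℕ) :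
    selectedExcess S (fun _ => x) ω n - selectedExcess S (fun _ => y) ω n =
      (y - x) * selectionCount S ω n := by
  rw [selectedExcess, selectedExcess, selectionCount, ← Finset.sum_sub_distrib, Finset.mul_sum]
  exact Finset.sum_congr rfl fun k _ => by ring

/-- A path cannot be random, in whichever senses, for one forecasting system whose forecasts are at
most `d` and for another whose forecasts are at least `r > d` on the situations of a recursive set
that the path visits infinitely often. -/
theorem not_isRandom_of_separated {R R' : Notion} {φ ψ : ForecastingSystem} {ω : Path}
    (hφ : IsRandom R φ ω) (hψ : IsRandom R' ψ ω) {S : Situation → Bool} (hS : Computable S)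
    (hfreq : ∃ᶠ n in atTop, S (initialSegment ω n) = true) {d r : ℚ} (d0 : 0 ≤ d) (hdr : d < r)
    (r1 : r ≤ 1) (hd : ∀ s, S s = true → upperForecast ψ s ≤ d)
    (hr : ∀ s, S s = true → (r : ℝ) ≤ lowerForecast φ s) : False := by
  have hC := tendsto_selectionCount hfreq
  have hpos : (0 : ℝ) < (r - d) / 3 := by
    have : (d : ℝ) < r := by exact_mod_cast hdr
    linarith
  obtain ⟨n, h1, h2, h3⟩ :=
    ((hφ.eventually_le_excess hS hC (d0.trans hdr.le) r1 hr hpos).and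
      ((hψ.eventually_excess_le hS hC d0 (hdr.le.trans r1) hd hpos).and
        (hC.eventually_gt_atTop 0))).exists
  -- the two excesses differ by `r - d` times the count, and each of them gives away a third of it
  have h4 := selectedExcess_const_sub S ω d r n
  have := mul_pos hpos h3
  linarith

/-- Every stationary forecast for which the path is random contains the interval of forecasts along
the path. -/
theorem forecastInterval_subset_of_isRandom {R R' : Notion} {φ : ForecastingSystem} {ω : Path}
    (h : IsRandom R φ ω) (hcomp : IsComputable φ) (hprec : IsPrecise φ) {J : IntervalForecast}
    (hJ : IsRandom R' (stationary J) ω) :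
    forecastInterval φ ω ⊆ IntervalForecast.toSet J := by
  refine Set.Icc_subset_Icc (le_of_not_gt fun hlt => ?_) (le_of_not_gt fun hlt => ?_)
  -- infinitely many forecasts on the path are below `b`, where `b < d < r < min J`
  · obtain ⟨b, hlb, hbJ⟩ := exists_rat_btwn hlt
    obtain ⟨d, hbd, hdJ⟩ := exists_rat_btwn hbJ
    obtain ⟨r, hdr, hrJ⟩ := exists_rat_btwn hdJ
    obtain ⟨S, hS, hS1, hS2⟩ := hcomp.1.exists_separating (a := b) (b := d)
      (by exact_mod_cast hbd)
    have hfreq : ∃ᶠ n in atTop, (!S (initialSegment ω n)) = true := by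
      refine (frequently_lt_of_liminf_lt
        (isBoundedUnder_le_lowerForecast φ ω).isCoboundedUnder_ge hlb).mono fun n hn => ?_
      rw [Bool.not_eq_true']
      by_contra e
      exact absurd (hS1 _ (by simpa using e)) (not_le.2 hn)
    have hd : ∀ s, (!S s) = true → upperForecast φ s ≤ d := fun s hs => by
      rw [← hprec]
      exact hS2 s (by simpa using hs)
    obtain ⟨n, hn⟩ := hfreq.exists
    have d0 : (0 : ℝ) ≤ d := (upperForecast_nonneg φ _).trans (hd _ hn)
    have r1 : (r : ℝ) ≤ 1 := hrJ.le.trans (lowerForecast_le_one (stationary J) [])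
    exact not_isRandom_of_separated hJ h (Primrec.not.to_comp.comp hS) hfreq
      (by exact_mod_cast d0) (by exact_mod_cast hdr) (by exact_mod_cast r1) hd fun s _ => hrJ.le
  -- infinitely many forecasts on the path are above `b`, where `max J < d < r < b`
  · obtain ⟨d, hJd, hdu⟩ := exists_rat_btwn hlt
    obtain ⟨r, hdr, hru⟩ := exists_rat_btwn hdu
    obtain ⟨b, hrb, hbu⟩ := exists_rat_btwn hru
    obtain ⟨S, hS, hS1, hS2⟩ := hcomp.2.exists_separating (a := r) (b := b)
      (by exact_mod_cast hrb)
    have hfreq : ∃ᶠ n in atTop, S (initialSegment ω n) = true := by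
      refine (frequently_lt_of_lt_limsup
        (isBoundedUnder_ge_upperForecast φ ω).isCoboundedUnder_le hbu).mono fun n hn => ?_
      by_contra e
      exact absurd (hS2 _ (by simpa using e)) (not_le.2 hn)
    have hr : ∀ s, S s = true → (r : ℝ) ≤ lowerForecast φ s := fun s hs => by
      rw [hprec]
      exact hS1 s hs
    obtain ⟨n, hn⟩ := hfreq.exists
    have d0 : (0 : ℝ) ≤ d := (upperForecast_nonneg (stationary J) []).trans hJd.le
    have r1 : (r : ℝ) ≤ 1 := (hr _ hn).trans (lowerForecast_le_one φ _)
    exact not_isRandom_of_separated h hJ hS hfreq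
      (by exact_mod_cast d0) (by exact_mod_cast hdr) (by exact_mod_cast r1) (fun s _ => hJd.le) hr

/-- The intervals of `IsRandom.exists_stationary` squeeze the intersection interval of any notion
that is implied by the given one on stationary forecasts with rational bounds. -/
theorem intersectionInterval_eq_of_implies {R R' : Notion} {φ : ForecastingSystem} {ω : Path}
    (h : IsRandom R φ ω) (hcomp : IsComputable φ) (hprec : IsPrecise φ)
    (himp : ∀ (I : IntervalForecast) (a b : ℚ), IntervalForecast.lo I = a →
      IntervalForecast.hi I = b → IsRandom R (stationary I) ω → IsRandom R' (stationary I) ω) :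
    intersectionInterval R' ω = forecastInterval φ ω := by
  refine Set.Subset.antisymm (fun z hz => ?_)
    (Set.subset_iInter₂ fun J hJ => forecastInterval_subset_of_isRandom h hcomp hprec hJ)
  have key : ∀ x y : ℝ, x < liminf (fun n => lowerForecast φ (initialSegment ω n)) atTop →
      limsup (fun n => upperForecast φ (initialSegment ω n)) atTop < y → x ≤ z ∧ z ≤ y := by
    intro x y hx hy
    obtain ⟨I, a, b, ha, hb, hxI, hIy, hI⟩ := h.exists_stationary hcomp hx hy
    have hzI : z ∈ IntervalForecast.toSet I := Set.mem_iInter₂.1 hz I (himp I a b ha hb hI)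
    exact ⟨hxI.trans hzI.1, hzI.2.trans hIy⟩
  exact ⟨le_of_forall_lt_imp_le_of_dense fun x hx => (key x _ hx (lt_add_one _)).1,
    le_of_forall_gt_imp_ge_of_dense fun y hy => (key _ y (sub_one_lt _) hy).2⟩

end ImpreciseRandomness

theorem mainTheorem1 (R : ImpreciseRandomness.Notion) (ω : ImpreciseRandomness.Path)
    (φ : ImpreciseRandomness.ForecastingSystem)
    (hcomp : ImpreciseRandomness.IsComputable φ) (hprec : ImpreciseRandomness.IsPrecise φ)
    (hω : ImpreciseRandomness.IsRandom R φ ω) :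
    ImpreciseRandomness.intersectionInterval R ω = ImpreciseRandomness.forecastInterval φ ω ∧
      ImpreciseRandomness.intersectionInterval ImpreciseRandomness.Notion.CH ω =
        ImpreciseRandomness.forecastInterval φ ω :=
  ⟨ImpreciseRandomness.intersectionInterval_eq_of_implies hω hcomp hprec fun _ _ _ _ _ hI => hI,
    ImpreciseRandomness.intersectionInterval_eq_of_implies hω hcomp hprec
      fun _ _ _ ha hb hI => hI.churchRandom_stationary ha hb⟩
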